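/- **Theorem (Stability of error moments).** Consider $N$ agents partitioned into groups $\mathcal{G}_1,\dots,\mathcal{G}_G$. Agent $k$ has a cost $J_k:\mathbb{R}^M\to\mathbb{R}$ that is strictly convex and twice differentiable, with $\lambda_{k,L} I_M\le\nabla^2 J_k(w)\le\lambda_{k,U} I_M$ for all $w$, where $0\le\lambda_{k,L}\le\lambda_{k,U}<\infty$, and that is minimized at $w_k^o$. Agents of the same group have the same minimizer, and every group contains an agent $k$ with $\lambda_{k,L}>0$. Let $A=[a_{\ell k}]$ be an $N\times N$ matrix with $a_{\ell k}=0$ whenever $\ell,k$ lie in different groups, whose diagonal block $A_m=[a_{\ell k}]_{\ell,k\in\mathcal{G}_m}$ is, for every $m$, left-stochastic (nonnegative entries, columns summing to one) and primitive (some positive power has only positive entries). Starting from $\boldsymbol{w}_{k,-1}=0$, the agents run, for $i\ge 0$, the diffusion recursion $$\boldsymbol{\psi}_{k,i}=\boldsymbol{w}_{k,i-1}-\mu_k\,\widehat{\nabla J_k}(\boldsymbol{w}_{k,i-1}),\qquad \boldsymbol{w}_{k,i}=\sum_{\ell} a_{\ell k}\,\boldsymbol{\psi}_{\ell,i},$$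 with step-sizes $\mu_k>0$ and random gradient approximations $\widehat{\nabla J_k}$ (which may change with $i$). Write $\mathcal{W}=\mathrm{col}\{w_1,\dots,w_N\}$, $\mathcal{W}^o=\mathrm{col}\{w_1^o,\dots,w_N^o\}$, let $\mathcal{S}_i(\mathcal{W})=\mathrm{col}\{\widehat{\nabla J_k}(w_k)-\nabla J_k(w_k)\}_{k=1}^N$ be the gradient noise at iteration $i$, and let $(\mathbb{F}_i)_{i\ge -1}$ be a filtration such that, for every $i\ge0$ and every $\mathbb{F}_{i-1}$-measurable random vector $\boldsymbol{\mathcal{W}}$ with finite fourth moment, $\mathcal{S}_i(\boldsymbol{\mathcal{W}})$ is $\mathbb{F}_i$-measurable and, almost surely, $$\mathbb{E}[\mathcal{S}_i(\boldsymbol{\mathcal{W}})\mid\mathbb{F}_{i-1}]=0,\qquad \mathbb{E}[\|\mathcal{S}_i(\boldsymbol{\mathcal{W}})\|^4\mid\mathbb{F}_{i-1}]\le\alpha^2\|\mathcal{W}^o-\boldsymbol{\mathcal{W}}\|^4+\sigma_s^4,$$ where $\alpha,\sigma_s\ge0$ are constants. Let $\mu_{\max}=\max_k\mu_k$ and $\widetilde{\boldsymbol{\mathcal{W}}}_i=\mathcal{W}^o-\mathrm{col}\{\boldsymbol{w}_{1,i},\dots,\boldsymbol{w}_{N,i}\}$.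 Then for every $\rho>0$ there are constants $\mu_0>0$ and $C\ge0$ such that, for all step-sizes with $\mu_k\ge\rho\,\mu_{\max}$ for all $k$ and $\mu_{\max}\le\mu_0$, $$\limsup_{i\to\infty}\mathbb{E}\|\widetilde{\boldsymbol{\mathcal{W}}}_i\|^2\le C\mu_{\max},\qquad \limsup_{i\to\infty}\mathbb{E}\|\widetilde{\boldsymbol{\mathcal{W}}}_i\|^4\le C\mu_{\max}^2.$$ -/

import Mathlib

open MeasureTheory ProbabilityTheory Filter
open scoped Gradient ENNReal RealInnerProductSpace

namespace DiffusionNetwork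

/-- The parameter space `ℝ^M` with the Euclidean norm. -/
abbrev Vec (M : ℕ) : Type := EuclideanSpace ℝ (Fin M)

/-- Network vectors `col{w_1, …, w_N} ∈ ℝ^{NM}` with the Euclidean norm. -/
abbrev NetVec (N M : ℕ) : Type := PiLp 2 (fun _ : Fin N => Vec M)

/-- The block `A_m = [a_{ℓk}; ℓ, k ∈ 𝒢_m]` of the combination matrix, where `𝒢_m` is the set of
agents `k` with `grp k = m`. -/
def groupMatrix {N G : ℕ} (A : Matrix (Fin N) (Fin N) ℝ) (grp : Fin N → Fin G) (m : Fin G) :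
    Matrix {k : Fin N // grp k = m} {k : Fin N // grp k = m} ℝ :=
  A.submatrix Subtype.val Subtype.val

/-- Conditions on the combination coefficients `A ℓ k = a_{ℓk}`: agents combine only within their
group, and every group block is a primitive left-stochastic matrix (nonnegativity of the entries
is part of primitivity). -/
structure IsCombinationPolicy {N G : ℕ} (grp : Fin N → Fin G)
    (A : Matrix (Fin N) (Fin N) ℝ) : Prop where
  off_group : ∀ l k, grp l ≠ grp k → A l k = 0
  leftStochastic : ∀ k, ∑ l, A l k = 1
  primitive : ∀ m, (groupMatrix A grp m).IsPrimitive

/-- A combination matrix that is supported on the in-group neighborhoods of a graph (every agent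
being a neighbor of itself), with positive coefficients there and unit column sums, is a
combination policy as soon as every group is connected. -/
theorem IsCombinationPolicy.of_connected {N G : ℕ} (grp : Fin N → Fin G)
    (A : Matrix (Fin N) (Fin N) ℝ) (T : SimpleGraph (Fin N))
    (hT : ∀ m, (T.induce {k | grp k = m}).Connected)
    (hpos : ∀ l k, (l = k ∨ T.Adj l k) ∧ grp l = grp k → 0 < A l k)
    (hzero : ∀ l k, ¬ ((l = k ∨ T.Adj l k) ∧ grp l = grp k) → A l k = 0)
    (hsum : ∀ k, ∑ l, A l k = 1) : IsCombinationPolicy grp A := by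
  refine ⟨fun l k h => hzero l k fun h' => h h'.2, hsum, fun m => ?_⟩
  set B := groupMatrix A grp m with hB
  have hnn : ∀ l k, 0 ≤ B l k := fun l k => by
    by_cases h : ((l : Fin N) = k ∨ T.Adj l k) ∧ grp l = grp k
    · exact (hpos _ _ h).le
    · exact (hzero _ _ h).ge
  have hstep : ∀ (n : ℕ) l j k, 0 < (B ^ n) l j → 0 < B j k → 0 < (B ^ (n + 1)) l k := by
    intro n l j k h1 h2
    rw [pow_succ, Matrix.mul_apply]
    exact Finset.sum_pos' (fun x _ => mul_nonneg (Matrix.pow_apply_nonneg hnn n l x) (hnn x k))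
      ⟨j, Finset.mem_univ _, mul_pos h1 h2⟩
  have hself : ∀ k, 0 < B k k := fun k => hpos _ _ ⟨Or.inl rfl, rfl⟩
  have hmono : ∀ (n d : ℕ) l k, 0 < (B ^ n) l k → 0 < (B ^ (n + d)) l k := by
    intro n d l k h
    induction d with
    | zero => exact h
    | succ d ih => exact hstep (n + d) l k k ih (hself k)
  have hex : ∀ l k, ∃ n : ℕ, 0 < (B ^ n) l k := by
    intro l k
    have hr : Relation.ReflTransGen (T.induce {k | grp k = m}).Adj l k :=
      (SimpleGraph.reachable_iff_reflTransGen _ _).1 ((hT m).preconnected l k)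
    induction hr with
    | refl => exact ⟨0, by simp⟩
    | @tail b c _ hbc ih =>
      obtain ⟨n, hn⟩ := ih
      have hb : grp b = m := b.2
      have hc : grp c = m := c.2
      exact ⟨n + 1, hstep n l b c hn (hpos _ _ ⟨Or.inr hbc, hb.trans hc.symm⟩)⟩
  choose f hf using hex
  refine ⟨hnn, (∑ l, ∑ k, f l k) + 1, Nat.succ_pos _, fun l k => ?_⟩
  have h1 : f l k ≤ ∑ k', f l k' :=
    Finset.single_le_sum (f := fun k' => f l k') (fun _ _ => Nat.zero_le _) (Finset.mem_univ k)
  have h2 : ∑ k', f l k' ≤ ∑ l', ∑ k', f l' k' :=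
    Finset.single_le_sum (f := fun l' => ∑ k', f l' k') (fun _ _ => Nat.zero_le _)
      (Finset.mem_univ l)
  obtain ⟨d, hd⟩ := Nat.exists_eq_add_of_le (h1.trans (h2.trans (Nat.le_succ _)))
  rw [Nat.succ_eq_add_one] at hd
  rw [hd]
  exact hmono _ d l k (hf l k)

/-- The Hessian of `f` at `w`, as the derivative of the gradient field. -/
noncomputable def hessian {M : ℕ} (f : Vec M → ℝ) (w : Vec M) : Vec M →L[ℝ] Vec M :=
  fderiv ℝ (∇ f) w

/-- Conditions on the individual costs `J k`, their minimizers `wo k`, and the bounds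
`lamL k • I ≤ ∇²J_k ≤ lamU k • I`. Agents of the same group belong to the same cluster, that is,
their costs share the minimizer. -/
structure IsCostFamily {N M G : ℕ} (grp : Fin N → Fin G) (J : Fin N → Vec M → ℝ)
    (wo : NetVec N M) (lamL lamU : Fin N → ℝ) : Prop where
  strictConvex : ∀ k, StrictConvexOn ℝ Set.univ (J k)
  differentiable : ∀ k, Differentiable ℝ (J k)
  differentiable_gradient : ∀ k, Differentiable ℝ (∇ (J k))
  minimizer : ∀ k, IsMinOn (J k) Set.univ (wo k)
  common_minimizer : ∀ k l, grp k = grp l → wo k = wo l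
  lamL_nonneg : ∀ k, 0 ≤ lamL k
  hessian_lower : ∀ k w v, lamL k * ‖v‖ ^ 2 ≤ ⟪v, hessian (J k) w v⟫
  hessian_upper : ∀ k w v, ⟪v, hessian (J k) w v⟫ ≤ lamU k * ‖v‖ ^ 2
  strong : ∀ m, ∃ k, grp k = m ∧ 0 < lamL k

/-- The network gradient `∇J(W) = col{∇J_1(w_1), …, ∇J_N(w_N)}`. -/
noncomputable def netGrad {N M : ℕ} (J : Fin N → Vec M → ℝ) (W : NetVec N M) : NetVec N M :=
  WithLp.toLp 2 fun k => ∇ (J k) (W k)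

/-- The network stochastic gradient at `W`, where `g k w` is the approximation of `∇J_k(w)`
available to agent `k`. -/
noncomputable def netApproxGrad {N M : ℕ} (g : Fin N → Vec M → Vec M) (W : NetVec N M) :
    NetVec N M :=
  WithLp.toLp 2 fun k => g k (W k)

/-- The network gradient noise: stochastic gradient minus true gradient. -/
noncomputable def gradNoise {N M : ℕ} (J : Fin N → Vec M → ℝ) (g : Fin N → Vec M → Vec M)
    (W : NetVec N M) : NetVec N M :=
  netApproxGrad g W - netGrad J W

/-- Conditions on the gradient noise. Here `gHat i ω k w` is the approximation of `∇J_k(w)` that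
agent `k` uses in the step from the `i`-th to the `(i+1)`-st iterate, and `ℱ i` is the information
available at the `i`-th iterate. For every `ℱ i`-measurable `W` with finite fourth moment, the
noise at `W` is part of the information at `i + 1`, has zero conditional mean given `ℱ i`, and has
conditional fourth moment at most `α² ‖W° - W‖⁴ + σ⁴`. Integrability of the fourth power is implied
by that bound for the conditional expectation of nonnegative variables; it is listed because
Mathlib's conditional expectation is zero on non-integrable functions. -/
structure IsGradientNoise {N M : ℕ} {Ω : Type*} {mΩ : MeasurableSpace Ω} (P : Measure Ω)
    (ℱ : Filtration ℕ mΩ) (J : Fin N → Vec M → ℝ) (wo : NetVec N M)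
    (gHat : ℕ → Ω → Fin N → Vec M → Vec M) (α σ : ℝ) : Prop where
  adapted : ∀ (i : ℕ) (W : Ω → NetVec N M), StronglyMeasurable[ℱ i] W → MemLp W 4 P →
    StronglyMeasurable[ℱ (i + 1)] fun ω => gradNoise J (gHat i ω) (W ω)
  integrable : ∀ (i : ℕ) (W : Ω → NetVec N M), StronglyMeasurable[ℱ i] W → MemLp W 4 P →
    Integrable (fun ω => ‖gradNoise J (gHat i ω) (W ω)‖ ^ 4) P
  martingaleDifference : ∀ (i : ℕ) (W : Ω → NetVec N M), StronglyMeasurable[ℱ i] W →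
    MemLp W 4 P → P[fun ω => gradNoise J (gHat i ω) (W ω) | ℱ i] =ᵐ[P] 0
  fourthMoment : ∀ (i : ℕ) (W : Ω → NetVec N M), StronglyMeasurable[ℱ i] W → MemLp W 4 P →
    P[fun ω => ‖gradNoise J (gHat i ω) (W ω)‖ ^ 4 | ℱ i] ≤ᵐ[P]
      fun ω => α ^ 2 * ‖wo - W ω‖ ^ 4 + σ ^ 4

/-- One adapt-then-combine step with step-sizes `μ`:
`ψ_ℓ = w_ℓ - μ_ℓ ĝ_ℓ(w_ℓ)` and then `w_k' = ∑_ℓ a_{ℓk} ψ_ℓ`. -/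
noncomputable def atcStep {N M : ℕ} (A : Matrix (Fin N) (Fin N) ℝ) (μ : Fin N → ℝ)
    (g : Fin N → Vec M → Vec M) (W : NetVec N M) : NetVec N M :=
  WithLp.toLp 2 fun k => ∑ l, A l k • (W l - μ l • g l (W l))

/-- The network iterates of the diffusion strategy, started at zero. -/
noncomputable def iterate {N M : ℕ} {Ω : Type*} (A : Matrix (Fin N) (Fin N) ℝ) (μ : Fin N → ℝ)
    (gHat : ℕ → Ω → Fin N → Vec M → Vec M) : ℕ → Ω → NetVec N M
  | 0 => fun _ => 0
  | i + 1 => fun ω => atcStep A μ (gHat i ω) (iterate A μ gHat i ω)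

/-- The network error vector `W° - W_i`. -/
noncomputable def netError {N M : ℕ} {Ω : Type*} (A : Matrix (Fin N) (Fin N) ℝ) (μ : Fin N → ℝ)
    (gHat : ℕ → Ω → Fin N → Vec M → Vec M) (wo : NetVec N M) (i : ℕ) (ω : Ω) : NetVec N M :=
  wo - iterate A μ gHat i ω

/-- The largest step-size. -/
noncomputable def muMax {N : ℕ} (μ : Fin N → ℝ) : ℝ := ⨆ k, μ k

end DiffusionNetwork

/-! The error satisfies a recursion with a drift, namely a gradient step followed by averaging, plus
noise of zero conditional mean and size of the order of the step-sizes. The difficulty is that an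
agent with `lamL k = 0` does not contract by itself; the averaging must pass on the contraction of
the strongly convex agents of its group.

Jensen bounds the weights `q` by `A q` after averaging. The Perron vector `p = A p` makes averaging
nonexpansive, but leaves uneven gains `u * d l`. Using `q = p + u r`, where `A r` is at most `r + (d
- c) p`, cancels the unevenness to first order in `u`: every agent then contracts at a common rate
proportional to `c > 0`. Such an `r` exists because `c` can be taken as a `p`-weighted mean of `d`
in each group (`exists_weights_of_isPrimitive`, `weight_step_le`, `exists_contracting_weights`). The
weights depend on `u = muMax μ`, but their bounds and the rate `κ` do not.

Fourth powers are treated directly: the term linear in the noise has zero mean, and the other cross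
terms cost a factor `1 + δ` and `1 / δ` times the fourth moment of the noise. With `δ = κ u` the
noise enters at order `u ^ 3` against a contraction `1 - κ u / 2`, which leaves `u ^ 2` in the
limit. The second moment follows from the fourth by Young's inequality. -/

namespace DiffusionNetwork

/-! ### Perron vectors and first-order corrections of left-stochastic matrices -/

section Weights

variable {n : Type*} [Fintype n] {B : Matrix n n ℝ}

lemma sum_mulVec_of_leftStochastic (hB : ∀ k, ∑ l, B l k = 1) (v : n → ℝ) :
    ∑ l, B.mulVec v l = ∑ k, v k := by
  simp only [Matrix.mulVec, dotProduct]
  rw [Finset.sum_comm]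
  simp [← Finset.sum_mul, hB]

lemma vecMul_one_of_leftStochastic (hB : ∀ k, ∑ l, B l k = 1) :
    Matrix.vecMul (fun _ => (1 : ℝ)) B = fun _ => 1 := by
  ext k
  simp [Matrix.vecMul, dotProduct, hB]

variable [DecidableEq n]

lemma pow_mulVec_eq_of_fixed {v : n → ℝ} (h : B.mulVec v = v) (k : ℕ) :
    (B ^ k).mulVec v = v := by
  induction k with
  | zero => simp
  | succ k ih => rw [pow_succ, ← Matrix.mulVec_mulVec, h, ih]

lemma vecMul_pow_eq_of_fixed {v : n → ℝ} (h : Matrix.vecMul v B = v) (k : ℕ) :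
    Matrix.vecMul v (B ^ k) = v := by
  induction k with
  | zero => simp
  | succ k ih => rw [pow_succ, ← Matrix.vecMul_vecMul, ih, h]

/-- A primitive left-stochastic matrix has a fixed vector with positive entries. -/
lemma exists_pos_fixed_of_isPrimitive [Nonempty n] (hP : B.IsPrimitive)
    (hB : ∀ k, ∑ l, B l k = 1) : ∃ p : n → ℝ, (∀ k, 0 < p k) ∧ B.mulVec p = p := by
  -- The all-ones vector is a left fixed vector, so `B - 1` is singular and a right fixed vector
  -- exists as well.
  have hdet : (B - 1).det = 0 := by
    rw [← Matrix.exists_vecMul_eq_zero_iff]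
    refine ⟨fun _ => 1, fun h => one_ne_zero (congrFun h (Classical.arbitrary n)), ?_⟩
    rw [Matrix.vecMul_sub, vecMul_one_of_leftStochastic hB, Matrix.vecMul_one, sub_self]
  obtain ⟨v, hv0, hv⟩ := Matrix.exists_mulVec_eq_zero_iff.2 hdet
  rw [Matrix.sub_mulVec, Matrix.one_mulVec, sub_eq_zero] at hv
  have hle : ∀ l, |v l| ≤ B.mulVec (fun k => |v k|) l := fun l => by
    conv_lhs => rw [← hv]
    refine (Finset.abs_sum_le_sum_abs _ _).trans_eq ?_
    simp [Matrix.mulVec, dotProduct, abs_mul, abs_of_nonneg (hP.nonneg _ _)]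
  -- `B` preserves the sum of the entries, so the entrywise inequality `hle` cannot be strict
  -- anywhere.
  have heq : B.mulVec (fun k => |v k|) = fun k => |v k| := by
    ext l
    exact (((Finset.sum_eq_sum_iff_of_le fun l _ => hle l).1
      (sum_mulVec_of_leftStochastic hB _).symm) l (Finset.mem_univ l)).symm
  obtain ⟨k, -, hk⟩ := hP.exists_pos_pow
  obtain ⟨j, hj⟩ := Function.ne_iff.1 hv0
  refine ⟨fun k => |v k|, fun l => ?_, heq⟩
  refine lt_of_lt_of_eq ?_ (congrFun (pow_mulVec_eq_of_fixed heq k) l)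
  exact Finset.sum_pos' (fun i _ => mul_nonneg (hk l i).le (abs_nonneg _))
    ⟨j, Finset.mem_univ _, mul_pos (hk l j) (abs_pos.2 hj)⟩

/-- The left fixed vectors of a primitive left-stochastic matrix are constant. -/
lemma eq_of_vecMul_fixed [Nonempty n] (hP : B.IsPrimitive) (hB : ∀ k, ∑ l, B l k = 1)
    {x : n → ℝ} (hx : Matrix.vecMul x B = x) : ∃ t, ∀ i, x i = t := by
  obtain ⟨k, -, hk⟩ := hP.exists_pos_pow
  -- Maximum principle: the largest entry is an average of all entries with the positive weights of
  -- a column of `B ^ k`.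
  obtain ⟨j, -, hj⟩ := Finset.exists_max_image Finset.univ x Finset.univ_nonempty
  refine ⟨x j, fun i => ?_⟩
  have h1 := congrFun (vecMul_pow_eq_of_fixed hx k) j
  have h2 := congrFun (vecMul_pow_eq_of_fixed (vecMul_one_of_leftStochastic hB) k) j
  simp only [Matrix.vecMul, dotProduct, one_mul] at h1 h2
  have h3 : ∑ l, (x j - x l) * (B ^ k) l j = 0 := by
    simp only [sub_mul, Finset.sum_sub_distrib, ← Finset.mul_sum, h1, h2]
    ring
  have h4 := (Finset.sum_eq_zero_iff_of_nonneg fun l _ =>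
    mul_nonneg (sub_nonneg.2 (hj l (Finset.mem_univ l))) (hk l j).le).1 h3 i (Finset.mem_univ i)
  have := (mul_eq_zero.1 h4).resolve_right (hk i j).ne'
  linarith

/-- For a primitive left-stochastic matrix `B`, the equation `r - B r = b` is solvable whenever the
entries of `b` sum to zero. -/
lemma exists_sub_mulVec_eq [Nonempty n] (hP : B.IsPrimitive) (hB : ∀ k, ∑ l, B l k = 1)
    {b : n → ℝ} (hb : ∑ k, b k = 0) : ∃ r : n → ℝ, r - B.mulVec r = b := by
  obtain ⟨p, hp, hBp⟩ := exists_pos_fixed_of_isPrimitive hP hB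
  have hps : 0 < ∑ k, p k := Finset.sum_pos (fun k _ => hp k) Finset.univ_nonempty
  -- The rank-one term removes the kernel of `1 - B`. Pairing a left null vector with `p` gives `x
  -- ⬝ᵥ p = 0`; then `x` is left fixed, hence constant, hence zero.
  have hdet : (1 - B + Matrix.vecMulVec p fun _ => 1).det ≠ 0 := by
    intro h
    obtain ⟨x, hx0, hx⟩ := Matrix.exists_vecMul_eq_zero_iff.2 h
    have hE : ∀ j, x j - Matrix.vecMul x B j + x ⬝ᵥ p = 0 := fun j => by
      have := congrFun hx j
      simpa [Matrix.vecMul_add, Matrix.vecMul_sub, Matrix.vecMul_vecMulVec] using this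
    have hxp : x ⬝ᵥ p = 0 := by
      have h1 : Matrix.vecMul x B ⬝ᵥ p = x ⬝ᵥ p := by rw [← Matrix.dotProduct_mulVec, hBp]
      have h2 : ∑ j, (x j - Matrix.vecMul x B j + x ⬝ᵥ p) * p j = 0 := by simp [hE]
      simp only [add_mul, sub_mul, Finset.sum_add_distrib, Finset.sum_sub_distrib,
        ← Finset.mul_sum] at h2
      change x ⬝ᵥ p - Matrix.vecMul x B ⬝ᵥ p + _ = 0 at h2
      rw [h1, sub_self, zero_add] at h2
      exact (mul_eq_zero.1 h2).resolve_right hps.ne'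
    obtain ⟨t, ht⟩ := eq_of_vecMul_fixed hP hB (x := x) (by
      ext j; have := hE j; rw [hxp] at this; linarith)
    simp only [dotProduct, ht, ← Finset.mul_sum] at hxp
    have ht0 := (mul_eq_zero.1 hxp).resolve_right hps.ne'
    exact hx0 (funext fun i => by simp [ht, ht0])
  set D := 1 - B + Matrix.vecMulVec p fun _ => 1 with hD
  refine ⟨D⁻¹.mulVec b, ?_⟩
  set r := D⁻¹.mulVec b
  have hr : D.mulVec r = b := by
    rw [Matrix.mulVec_mulVec, Matrix.mul_nonsing_inv _ (isUnit_iff_ne_zero.2 hdet),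
      Matrix.one_mulVec]
  have hE : ∀ j, r j - B.mulVec r j + p j * ∑ k, r k = b j := fun j => by
    rw [← hr, hD, Matrix.add_mulVec, Matrix.sub_mulVec, Matrix.one_mulVec]
    simp [Matrix.mulVec, Matrix.vecMulVec, dotProduct, Finset.mul_sum]
  -- Summing the entries isolates the rank-one term, which therefore vanishes in the equation for
  -- `r`.
  have hs : ∑ k, r k = 0 := by
    have h1 : ∑ j, (r j - B.mulVec r j + p j * ∑ k, r k) = 0 := by simp [hE, hb]
    rw [Finset.sum_add_distrib, Finset.sum_sub_distrib, sum_mulVec_of_leftStochastic hB,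
      ← Finset.sum_mul, sub_self, zero_add] at h1
    exact (mul_eq_zero.1 h1).resolve_left hps.ne'
  ext j
  have := hE j
  rw [hs] at this
  simpa using this

/-- A fixed vector `p` of a primitive left-stochastic matrix, together with a first-order
correction `r` that spreads the nonnegative rates `d` evenly. -/
lemma exists_weights_of_isPrimitive [Nonempty n] (hP : B.IsPrimitive) (hB : ∀ k, ∑ l, B l k = 1)
    {d : n → ℝ} (hd : ∀ k, 0 ≤ d k) (hd' : ∃ k, 0 < d k) :
    ∃ (p r : n → ℝ) (c : ℝ), 0 < c ∧ (∀ k, 0 < p k) ∧ (∀ l, ∑ k, B l k * p k = p l) ∧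
      ∀ l, ∑ k, B l k * r k = r l + (d l - c) * p l := by
  obtain ⟨p, hp, hBp⟩ := exists_pos_fixed_of_isPrimitive hP hB
  have hps : 0 < ∑ k, p k := Finset.sum_pos (fun k _ => hp k) Finset.univ_nonempty
  obtain ⟨j, hj⟩ := hd'
  have hds : 0 < ∑ k, d k * p k := Finset.sum_pos'
    (fun k _ => mul_nonneg (hd k) (hp k).le) ⟨j, Finset.mem_univ _, mul_pos hj (hp j)⟩
  -- The `p`-weighted mean of the rates is the only value for which `(c - d) p` sums to zero, as
  -- solvability requires.
  set c := (∑ k, d k * p k) / ∑ k, p k with hc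
  obtain ⟨r, hr⟩ := exists_sub_mulVec_eq hP hB (b := fun l => (c - d l) * p l) (by
    simp only [sub_mul, Finset.sum_sub_distrib, ← Finset.mul_sum]
    rw [hc, div_mul_cancel₀ _ hps.ne', sub_self])
  refine ⟨p, r, c, div_pos hds hps, hp, fun l => congrFun hBp l, fun l => ?_⟩
  have := congrFun hr l
  simp only [Pi.sub_apply, Matrix.mulVec, dotProduct] at this
  linarith

end Weights

/-- Weights for all groups of a combination policy at once. -/
lemma IsCombinationPolicy.exists_weights {N G : ℕ} {grp : Fin N → Fin G}
    {A : Matrix (Fin N) (Fin N) ℝ} (hA : IsCombinationPolicy grp A) {d : Fin N → ℝ}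
    (hd : ∀ k, 0 ≤ d k) (hd' : ∀ m, ∃ k, grp k = m ∧ 0 < d k) :
    ∃ (p r : Fin N → ℝ) (c : ℝ), 0 < c ∧ (∀ k, 0 < p k) ∧ (∀ l, ∑ k, A l k * p k = p l) ∧
      ∀ l, ∑ k, A l k * r k ≤ r l + (d l - c) * p l := by
  have key : ∀ m, ∃ (p r : {k : Fin N // grp k = m} → ℝ) (c : ℝ), 0 < c ∧ (∀ k, 0 < p k) ∧
      (∀ l, ∑ k, groupMatrix A grp m l k * p k = p l) ∧
      ∀ l, ∑ k, groupMatrix A grp m l k * r k = r l + (d l - c) * p l := by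
    intro m
    obtain ⟨k₀, hk₀, hk₀'⟩ := hd' m
    have : Nonempty {k : Fin N // grp k = m} := ⟨⟨k₀, hk₀⟩⟩
    refine exists_weights_of_isPrimitive (d := fun k : {k : Fin N // grp k = m} => d k)
      (hA.primitive m) (fun k => ?_) (fun k => hd k) ⟨⟨k₀, hk₀⟩, hk₀'⟩
    rw [← hA.leftStochastic k]
    symm
    refine (Finset.sum_subset_zero_on_sdiff (Finset.subset_univ
      (Finset.univ.filter fun l => grp l = m)) (fun l hl => hA.off_group l k ?_)
      (fun _ _ => rfl)).symm.trans ?_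
    · rw [k.2]; simpa using hl
    · exact Finset.sum_subtype _ (by simp) _
  choose p r c hc hp hp1 hr1 using key
  have hsum : ∀ (f : ∀ m, {k : Fin N // grp k = m} → ℝ) (l : Fin N),
      ∑ k, A l k * f (grp k) ⟨k, rfl⟩ =
        ∑ k, groupMatrix A grp (grp l) ⟨l, rfl⟩ k * f (grp l) k := by
    intro f l
    have h1 : ∑ k, A l k * f (grp k) ⟨k, rfl⟩ =
        ∑ k ∈ Finset.univ.filter (fun k => grp k = grp l), A l k * f (grp k) ⟨k, rfl⟩ := by
      refine (Finset.sum_subset_zero_on_sdiff (Finset.subset_univ _) (fun k hk => ?_)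
        (fun _ _ => rfl)).symm
      rw [hA.off_group l k (by simpa [eq_comm] using hk), zero_mul]
    rw [h1, Finset.sum_subtype _ (p := fun k => grp k = grp l) (by simp)]
    refine Finset.sum_congr rfl fun k _ => ?_
    obtain ⟨k, hk⟩ := k
    simp only [groupMatrix, Matrix.submatrix_apply]
    congr 1
    generalize grp l = m at hk
    subst hk
    rfl
  -- The groups have different mean rates; passing to the smallest one turns the equation for `r`
  -- into an inequality.
  obtain ⟨c₀, hc₀, hc₀'⟩ : ∃ c₀ : ℝ, 0 < c₀ ∧ ∀ m, c₀ ≤ c m := by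
    by_cases hG : Nonempty (Fin G)
    · obtain ⟨m, -, hm⟩ := Finset.exists_min_image Finset.univ c Finset.univ_nonempty
      exact ⟨c m, hc m, fun m' => hm m' (Finset.mem_univ _)⟩
    · exact ⟨1, one_pos, fun m => (hG ⟨m⟩).elim⟩
  refine ⟨fun k => p (grp k) ⟨k, rfl⟩, fun k => r (grp k) ⟨k, rfl⟩, c₀, hc₀, fun k => hp _ _,
    fun l => ?_, fun l => ?_⟩
  · rw [hsum p l, hp1]
  · rw [hsum r l, hr1]
    have := mul_le_mul_of_nonneg_right (hc₀' (grp l)) (hp (grp l) ⟨l, rfl⟩).le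
    dsimp only
    linarith

/-! ### Gradient bounds from Hessian bounds -/

section Calculus

variable {M : ℕ} {f : Vec M → ℝ}

lemma inner_hessian_symm (hf : Differentiable ℝ f) (hf' : Differentiable ℝ (∇ f))
    (w u v : Vec M) : ⟪u, hessian f w v⟫ = ⟪v, hessian f w u⟫ := by
  set B : Vec M →L[ℝ] Vec M →L[ℝ] ℝ :=
    (isBoundedBilinearMap_inner (𝕜 := ℝ) (E := Vec M)).toContinuousLinearMap with hB
  have h1 : ∀ y, HasFDerivAt f (B (∇ f y)) y := fun y => by
    have h := (hf y).hasGradientAt.hasFDerivAt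
    have he : InnerProductSpace.toDual ℝ (Vec M) (∇ f y) = B (∇ f y) := by
      ext v
      rw [InnerProductSpace.toDual_apply_apply]
      rfl
    rwa [he] at h
  have h2 : HasFDerivAt (fun y => B (∇ f y)) (B.comp (hessian f w)) w :=
    B.hasFDerivAt.comp w (hf' w).hasFDerivAt
  have : ⟪hessian f w u, v⟫ = ⟪hessian f w v, u⟫ := second_derivative_symmetric h1 h2 u v
  rw [real_inner_comm, ← this, real_inner_comm]

/-- Polarization of the symmetric form: `4 ⟪u, H v⟫` is the difference of the quadratic form at `u +
v` and `u - v`. The choice `u = L⁻¹ • H v` then gives the operator bound. -/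
lemma norm_hessian_apply_le (hf : Differentiable ℝ f) (hf' : Differentiable ℝ (∇ f))
    {L : ℝ} (hL : 0 < L) {w : Vec M} (h0 : ∀ v, 0 ≤ ⟪v, hessian f w v⟫)
    (hU : ∀ v, ⟪v, hessian f w v⟫ ≤ L * ‖v‖ ^ 2) (v : Vec M) :
    ‖hessian f w v‖ ≤ L * ‖v‖ := by
  set H := hessian f w with hH
  have key : ∀ u, 2 * ⟪u, H v⟫ ≤ L * (‖u‖ ^ 2 + ‖v‖ ^ 2) := fun u => by
    have h1 := hU (u + v)
    have h2 := h0 (u - v)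
    have hs := inner_hessian_symm hf hf' w u v
    have hn1 := norm_add_sq_real u v
    have hn2 := norm_sub_sq_real u v
    have h3 := h0 (u + v)
    have h4 := hU (u - v)
    have hpar : ‖u + v‖ ^ 2 + ‖u - v‖ ^ 2 = 2 * (‖u‖ ^ 2 + ‖v‖ ^ 2) := by rw [hn1, hn2]; ring
    simp only [map_add, map_sub, inner_add_left, inner_add_right, inner_sub_left,
      inner_sub_right] at h1 h2 h3 h4
    rw [← hH] at *
    nlinarith [sq_nonneg ‖u - v‖]
  have h := key (L⁻¹ • H v)
  rw [inner_smul_left, real_inner_self_eq_norm_sq, norm_smul, mul_pow] at h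
  simp only [conj_trivial, Real.norm_eq_abs, sq_abs] at h
  have h5 : ‖H v‖ ^ 2 ≤ (L * ‖v‖) ^ 2 := by
    field_simp at h
    nlinarith
  exact (sq_le_sq₀ (norm_nonneg _) (by positivity)).1 h5

lemma gradient_eq_zero_of_isMinOn {w : Vec M} (h : IsMinOn f Set.univ w) : ∇ f w = 0 := by
  have : IsLocalMin f w := h.isLocalMin Filter.univ_mem
  rw [gradient, this.fderiv_eq_zero, map_zero]

lemma norm_gradient_le (hf' : Differentiable ℝ (∇ f)) {L : ℝ}
    (hH : ∀ w v, ‖hessian f w v‖ ≤ L * ‖v‖) (hL : 0 ≤ L) {wo : Vec M} (h0 : ∇ f wo = 0)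
    (w : Vec M) : ‖∇ f w‖ ≤ L * ‖wo - w‖ := by
  have := Convex.norm_image_sub_le_of_norm_fderiv_le (𝕜 := ℝ) (f := ∇ f) (C := L)
    (fun x _ => hf' x) (fun x _ => ContinuousLinearMap.opNorm_le_bound _ hL (hH x)) convex_univ
    (Set.mem_univ wo) (Set.mem_univ w)
  rwa [h0, sub_zero, norm_sub_rev] at this

/-- Mean value theorem for `t ↦ ⟪v, ∇ f (wo + t • v)⟫` on the unit interval; no continuity of the
Hessian is needed. -/
lemma inner_gradient_ge (hf' : Differentiable ℝ (∇ f)) {lam : ℝ}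
    (hH : ∀ w v, lam * ‖v‖ ^ 2 ≤ ⟪v, hessian f w v⟫) {wo : Vec M} (h0 : ∇ f wo = 0)
    (w : Vec M) : lam * ‖wo - w‖ ^ 2 ≤ -⟪wo - w, ∇ f w⟫ := by
  set v := w - wo with hv
  have hd : ∀ t : ℝ, HasDerivAt (fun t : ℝ => ⟪v, ∇ f (wo + t • v)⟫)
      ⟪v, hessian f (wo + t • v) v⟫ t := fun t => by
    have h1 : HasDerivAt (fun t : ℝ => wo + t • v) v t := by
      simpa using ((hasDerivAt_id t).smul_const v).const_add wo
    have h2 := (hf' (wo + t • v)).hasFDerivAt.comp_hasDerivAt t h1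
    have h3 := (hasDerivAt_const t v).inner ℝ h2
    rw [inner_zero_left, add_zero] at h3
    exact h3
  obtain ⟨t, -, ht⟩ := exists_hasDerivAt_eq_slope _ _ (zero_lt_one' ℝ)
    (fun t _ => (hd t).continuousAt.continuousWithinAt) (fun t _ => hd t)
  have h3 := hH (wo + t • v) v
  rw [ht] at h3
  simp only [one_smul, zero_smul, add_zero, h0, inner_zero_right, sub_zero, div_one] at h3
  rw [show wo + v = w by simp [hv]] at h3
  rwa [norm_sub_rev, ← inner_neg_left, neg_sub]

end Calculus

/-- One gradient step contracts the squared distance to the minimizer up to second order. -/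
lemma IsCostFamily.exists_step_bound {N M G : ℕ} {grp : Fin N → Fin G} {J : Fin N → Vec M → ℝ}
    {wo : NetVec N M} {lamL lamU : Fin N → ℝ} (hJ : IsCostFamily grp J wo lamL lamU) :
    ∃ L : ℝ, 0 < L ∧ (∀ k w, ‖∇ (J k) w‖ ≤ L * ‖wo k - w‖) ∧ ∀ k w μ, 0 ≤ μ →
      ‖wo k - w + μ • ∇ (J k) w‖ ^ 2 ≤
        (1 - 2 * μ * lamL k + μ ^ 2 * L ^ 2) * ‖wo k - w‖ ^ 2 := by
  -- A bound common to all agents; the summand `1` keeps it positive.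
  set L := 1 + ∑ k, |lamU k| with hL
  have hL0 : 0 < L := by positivity
  have hLU : ∀ k, lamU k ≤ L := fun k =>
    (le_abs_self _).trans ((Finset.single_le_sum (f := fun k => |lamU k|)
      (fun _ _ => abs_nonneg _) (Finset.mem_univ k)).trans (by linarith))
  have hg0 : ∀ k, ∇ (J k) (wo k) = 0 := fun k => gradient_eq_zero_of_isMinOn (hJ.minimizer k)
  have hH : ∀ k w v, ‖hessian (J k) w v‖ ≤ L * ‖v‖ := fun k w v =>
    norm_hessian_apply_le (hJ.differentiable k) (hJ.differentiable_gradient k) hL0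
      (fun v => (mul_nonneg (hJ.lamL_nonneg k) (sq_nonneg _)).trans (hJ.hessian_lower k w v))
      (fun v => (hJ.hessian_upper k w v).trans
        (mul_le_mul_of_nonneg_right (hLU k) (sq_nonneg _))) v
  have hgL : ∀ k w, ‖∇ (J k) w‖ ≤ L * ‖wo k - w‖ := fun k w =>
    norm_gradient_le (hJ.differentiable_gradient k) (hH k) hL0.le (hg0 k) w
  refine ⟨L, hL0, hgL, fun k w μ hμ => ?_⟩
  have h1 := inner_gradient_ge (hJ.differentiable_gradient k) (hJ.hessian_lower k) (hg0 k) w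
  have h2 : ‖∇ (J k) w‖ ^ 2 ≤ (L * ‖wo k - w‖) ^ 2 :=
    pow_le_pow_left₀ (norm_nonneg _) (hgL k w) 2
  rw [norm_add_sq_real, inner_smul_right, norm_smul, mul_pow, Real.norm_eq_abs, sq_abs]
  have h3 := mul_le_mul_of_nonneg_left h1 hμ
  have h4 := mul_le_mul_of_nonneg_left h2 (sq_nonneg μ)
  linarith

/-! ### Combination and scaling as operators, and the weighted Jensen inequality -/

section Operators

variable {N M : ℕ}

/-- The combination step `x ↦ col{∑_ℓ a_{ℓk} x_ℓ}` as a continuous linear map. -/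
noncomputable def combine (A : Matrix (Fin N) (Fin N) ℝ) : NetVec N M →L[ℝ] NetVec N M where
  toFun x := WithLp.toLp 2 fun k => ∑ l, A l k • x l
  map_add' x y := by
    ext k : 1
    simp only [PiLp.add_apply, smul_add, Finset.sum_add_distrib]
  map_smul' t x := by
    ext k : 1
    simp only [PiLp.smul_apply, smul_comm _ t, Finset.smul_sum, RingHom.id_apply]
  cont := by fun_prop

/-- The agentwise scaling `x ↦ col{t_k x_k}` as a continuous linear map. -/
noncomputable def scale (t : Fin N → ℝ) : NetVec N M →L[ℝ] NetVec N M where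
  toFun x := WithLp.toLp 2 fun k => t k • x k
  map_add' x y := by
    ext k : 1
    simp only [PiLp.add_apply, smul_add]
  map_smul' s x := by
    ext k : 1
    simp only [PiLp.smul_apply, smul_comm _ s, RingHom.id_apply]
  cont := by fun_prop

lemma combine_apply (A : Matrix (Fin N) (Fin N) ℝ) (x : NetVec N M) (k : Fin N) :
    combine A x k = ∑ l, A l k • x l := rfl

lemma scale_apply (t : Fin N → ℝ) (x : NetVec N M) (k : Fin N) : scale t x k = t k • x k := rfl

lemma norm_scale_sq (t : Fin N → ℝ) (x : NetVec N M) :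
    ‖scale t x‖ ^ 2 = ∑ k, t k ^ 2 * ‖x k‖ ^ 2 := by
  simp [PiLp.norm_sq_eq_of_L2, scale_apply, norm_smul, mul_pow]

lemma norm_scale_le {t : Fin N → ℝ} {u : ℝ} (hu : 0 ≤ u) (ht : ∀ k, |t k| ≤ u)
    (x : NetVec N M) : ‖scale t x‖ ≤ u * ‖x‖ := by
  rw [← sq_le_sq₀ (norm_nonneg _) (by positivity), norm_scale_sq, mul_pow,
    PiLp.norm_sq_eq_of_L2, Finset.mul_sum]
  exact Finset.sum_le_sum fun k _ => mul_le_mul_of_nonneg_right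
    (sq_le_sq' (by linarith [neg_abs_le (t k), ht k]) ((le_abs_self _).trans (ht k))) (sq_nonneg _)

lemma le_norm_scale_sq {t : Fin N → ℝ} {a : ℝ} (ht : ∀ k, a ≤ t k ^ 2) (x : NetVec N M) :
    a * ‖x‖ ^ 2 ≤ ‖scale t x‖ ^ 2 := by
  rw [norm_scale_sq, PiLp.norm_sq_eq_of_L2, Finset.mul_sum]
  gcongr with k
  exact ht k

/-- Jensen's inequality for the combination step in a weighted norm. -/
lemma norm_scale_combine_sq_le {A : Matrix (Fin N) (Fin N) ℝ} (hA0 : ∀ l k, 0 ≤ A l k)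
    (hA1 : ∀ k, ∑ l, A l k = 1) (t : Fin N → ℝ) (y : NetVec N M) :
    ‖scale t (combine A y)‖ ^ 2 ≤ ∑ l, (∑ k, A l k * t k ^ 2) * ‖y l‖ ^ 2 := by
  have hk : ∀ k, ‖combine A y k‖ ^ 2 ≤ ∑ l, A l k * ‖y l‖ ^ 2 := fun k => by
    have h := ((convexOn_norm (E := Vec M) convex_univ).pow
      (fun _ _ => norm_nonneg _) 2).map_sum_le (t := Finset.univ) (w := fun l => A l k)
      (p := fun l => y l) (fun l _ => hA0 l k) (hA1 k) (fun _ _ => Set.mem_univ _)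
    simpa [combine_apply] using h
  calc ‖scale t (combine A y)‖ ^ 2 = ∑ k, t k ^ 2 * ‖combine A y k‖ ^ 2 := norm_scale_sq _ _
    _ ≤ ∑ k, t k ^ 2 * ∑ l, A l k * ‖y l‖ ^ 2 := by
        gcongr with k
        exact hk k
    _ = ∑ l, (∑ k, A l k * t k ^ 2) * ‖y l‖ ^ 2 := by
        simp only [Finset.mul_sum, Finset.sum_mul]
        rw [Finset.sum_comm]
        exact Finset.sum_congr rfl fun l _ => Finset.sum_congr rfl fun k _ => by ring

end Operators

/-! ### Contraction of the noise-free step for small step-sizes -/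

lemma eventually_mul_le (s : ℝ) {t : ℝ} (ht : 0 < t) :
    ∀ᶠ u : ℝ in nhdsWithin 0 (Set.Ioi 0), u * s ≤ t := by
  have h : Tendsto (fun u : ℝ => u * s) (nhdsWithin 0 (Set.Ioi 0)) (nhds 0) := by
    have := ((continuous_id.mul continuous_const).tendsto (0 : ℝ)).mono_left
      (nhdsWithin_le_nhds (s := Set.Ioi (0 : ℝ))) (f := fun u : ℝ => u * s)
    simpa using this
  exact (h.eventually (gt_mem_nhds ht)).mono fun u hu => hu.le

lemma exists_pos_forall_le {N : ℕ} {p : Fin N → ℝ} (hp : ∀ k, 0 < p k) :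
    ∃ a : ℝ, 0 < a ∧ ∀ k, a ≤ p k := by
  have h : ∀ᶠ u : ℝ in nhdsWithin 0 (Set.Ioi 0), ∀ k, u * 1 ≤ p k :=
    eventually_all.2 fun k => eventually_mul_le 1 (hp k)
  obtain ⟨a, ha, ha'⟩ := (h.and self_mem_nhdsWithin).exists
  exact ⟨a, ha', fun k => by simpa using ha k⟩

lemma IsCombinationPolicy.nonneg {N G : ℕ} {grp : Fin N → Fin G}
    {A : Matrix (Fin N) (Fin N) ℝ} (hA : IsCombinationPolicy grp A) (l k : Fin N) :
    0 ≤ A l k := by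
  by_cases h : grp l = grp k
  · exact (hA.primitive (grp k)).nonneg ⟨l, h⟩ ⟨k, rfl⟩
  · exact (hA.off_group l k h).ge

/-- The scalar inequality behind the contraction: first-order corrections of the weight absorb the
uneven rates `d` into the common rate `c`. -/
lemma weight_step_le {p r c d L u : ℝ} (hp : 0 < p) (hc : 0 < c) (hd : 0 ≤ d) (hu : 0 < u)
    (hu1 : u ≤ 1) (hur : u * |r| ≤ p / 2)
    (huK : u * (d * |r| + d * c * p + L ^ 2 * (p + |r|) + L ^ 2 * (d * p)) ≤ c * p / 2) :
    (p + u * r + u * ((d - c) * p)) * (1 - u * d + u ^ 2 * L ^ 2) ≤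
      (1 - c / 4 * u) * (p + u * r) := by
  have hr := le_abs_self r
  have hr' := neg_abs_le r
  -- The terms `± u * d * p` cancel, leaving the decrease `u * (c * p)`. Half of it pays for the
  -- second-order remainder, and `p + u * r ≤ 2 * p` turns the other half into the rate `c / 4`.
  have e : (p + u * r + u * ((d - c) * p)) * (1 - u * d + u ^ 2 * L ^ 2) =
      p + u * r - u * (c * p) + u * (u * (-(d * r) - d * (d - c) * p + L ^ 2 * (p + u * r)
        + L ^ 2 * (u * ((d - c) * p)))) := by ring
  have h1 : -(d * r) ≤ d * |r| := by nlinarith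
  have h2 : -(d * (d - c) * p) ≤ d * c * p := by nlinarith [mul_nonneg (mul_nonneg hd hd) hp.le]
  have h3 : p + u * r ≤ p + |r| := by nlinarith [abs_nonneg r]
  have h4 : u * ((d - c) * p) ≤ d * p := by
    nlinarith [mul_nonneg hd hp.le, mul_pos (mul_pos hu hc) hp]
  have h3' := mul_le_mul_of_nonneg_left h3 (sq_nonneg L)
  have h4' := mul_le_mul_of_nonneg_left h4 (sq_nonneg L)
  have h5 : u * (-(d * r) - d * (d - c) * p + L ^ 2 * (p + u * r)
      + L ^ 2 * (u * ((d - c) * p))) ≤ c * p / 2 :=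
    (mul_le_mul_of_nonneg_left (by linarith) hu.le).trans huK
  have h6 := mul_le_mul_of_nonneg_left h5 hu.le
  have h7 : p + u * r ≤ 2 * p := by nlinarith
  have h8 := mul_le_mul_of_nonneg_left h7 (mul_pos hc hu).le
  rw [e]
  nlinarith

/-- For small step-sizes there are weights for which one noise-free diffusion step contracts the
weighted error norm by a factor `1 - κ u`, where `u` bounds the step-sizes. -/
lemma exists_contracting_weights {N M G : ℕ} {grp : Fin N → Fin G}
    {A : Matrix (Fin N) (Fin N) ℝ} {J : Fin N → Vec M → ℝ} {wo : NetVec N M}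
    {lamL lamU : Fin N → ℝ} (hA : IsCombinationPolicy grp A)
    (hJ : IsCostFamily grp J wo lamL lamU) {ρ : ℝ} (hρ : 0 < ρ) :
    ∃ a b κ : ℝ, 0 < a ∧ 0 < b ∧ 0 < κ ∧ ∀ᶠ u in nhdsWithin (0 : ℝ) (Set.Ioi 0),
      ∃ t : Fin N → ℝ, (∀ k, a ≤ t k ^ 2) ∧ (∀ k, |t k| ≤ b) ∧
        ∀ μ : Fin N → ℝ, (∀ k, ρ * u ≤ μ k) → (∀ k, μ k ≤ u) → ∀ W : NetVec N M,
          ‖scale t (combine A (wo - W + scale μ (netGrad J W)))‖ ^ 2 ≤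
            (1 - κ * u) * ‖scale t (wo - W)‖ ^ 2 := by
  obtain ⟨L, hL, -, hstep⟩ := hJ.exists_step_bound
  -- Since `ρ * u ≤ μ k`, the guaranteed gain `2 * μ k * lamL k` is at least `u * d k`, whatever the
  -- individual step-sizes.
  set d : Fin N → ℝ := fun k => 2 * ρ * lamL k with hd
  have hd0 : ∀ k, 0 ≤ d k := fun k => mul_nonneg (by positivity) (hJ.lamL_nonneg k)
  obtain ⟨p, r, c, hc, hp, hAp, hAr⟩ := hA.exists_weights hd0 (fun m => by
    obtain ⟨k, hk, hk'⟩ := hJ.strong m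
    exact ⟨k, hk, by positivity⟩)
  obtain ⟨a, ha, hap⟩ := exists_pos_forall_le hp
  have hP1 : ∀ k, p k ≤ ∑ l, p l := fun k =>
    Finset.single_le_sum (fun l _ => (hp l).le) (Finset.mem_univ k)
  have hP0 : 0 ≤ ∑ l, p l := Finset.sum_nonneg fun l _ => (hp l).le
  refine ⟨a / 2, 1 + 2 * ∑ l, p l, c / 4, by positivity, by positivity, by positivity, ?_⟩
  have e1 : ∀ᶠ u : ℝ in nhdsWithin 0 (Set.Ioi 0), ∀ l, u * |r l| ≤ p l / 2 :=
    eventually_all.2 fun l => eventually_mul_le _ (half_pos (hp l))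
  have e2 : ∀ᶠ u : ℝ in nhdsWithin 0 (Set.Ioi 0), ∀ l, u * (d l * |r l| + d l * c * p l
      + L ^ 2 * (p l + |r l|) + L ^ 2 * (d l * p l)) ≤ c * p l / 2 :=
    eventually_all.2 fun l => eventually_mul_le _ (half_pos (mul_pos hc (hp l)))
  have e3 : ∀ᶠ u : ℝ in nhdsWithin 0 (Set.Ioi 0), ∀ l, u * d l ≤ 1 :=
    eventually_all.2 fun l => eventually_mul_le _ one_pos
  filter_upwards [e1, e2, e3, eventually_mul_le 1 one_pos, self_mem_nhdsWithin] with
    u h1 h2 h3 h4 hu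
  rw [mul_one] at h4
  replace hu : 0 < u := hu
  have hq0 : ∀ k, p k / 2 ≤ p k + u * r k := fun k => by
    have := mul_le_mul_of_nonneg_left (neg_abs_le (r k)) hu.le
    linarith [h1 k]
  have hq1 : ∀ k, p k + u * r k ≤ 2 * p k := fun k => by
    have := mul_le_mul_of_nonneg_left (le_abs_self (r k)) hu.le
    linarith [h1 k, hp k]
  have hsq : ∀ k, √(p k + u * r k) ^ 2 = p k + u * r k := fun k =>
    Real.sq_sqrt (by linarith [hq0 k, hp k])
  refine ⟨fun k => √(p k + u * r k), fun k => ?_, fun k => ?_, fun μ hμl hμu W => ?_⟩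
  · rw [hsq]
    linarith [hq0 k, hap k]
  · rw [abs_of_nonneg (Real.sqrt_nonneg _)]
    refine Real.sqrt_le_iff.2 ⟨by positivity, ?_⟩
    nlinarith [hq1 k, hP1 k]
  · refine (norm_scale_combine_sq_le hA.nonneg hA.leftStochastic _ _).trans ?_
    rw [norm_scale_sq, Finset.mul_sum]
    refine Finset.sum_le_sum fun l _ => ?_
    simp only [hsq]
    have hμ0 : 0 ≤ μ l := le_trans (by positivity) (hμl l)
    have hAq : ∑ k, A l k * (p k + u * r k) ≤ p l + u * r l + u * ((d l - c) * p l) := by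
      have : ∑ k, A l k * (p k + u * r k) = ∑ k, A l k * p k + u * ∑ k, A l k * r k := by
        rw [Finset.mul_sum, ← Finset.sum_add_distrib]
        exact Finset.sum_congr rfl fun k _ => by ring
      rw [this, hAp]
      have := mul_le_mul_of_nonneg_left (hAr l) hu.le
      linarith
    have hAq0 : 0 ≤ ∑ k, A l k * (p k + u * r k) := Finset.sum_nonneg fun k _ =>
      mul_nonneg (hA.nonneg l k) (by linarith [hq0 k, hp k])
    have hs : ‖(wo - W + scale μ (netGrad J W)) l‖ ^ 2 ≤
        (1 - u * d l + u ^ 2 * L ^ 2) * ‖(wo - W) l‖ ^ 2 := by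
      refine (hstep l (W l) (μ l) hμ0).trans ?_
      refine mul_le_mul_of_nonneg_right ?_ (sq_nonneg _)
      have h5 := mul_le_mul_of_nonneg_right (hμl l) (hJ.lamL_nonneg l)
      have h6 := mul_le_mul_of_nonneg_right (pow_le_pow_left₀ hμ0 (hμu l) 2) (sq_nonneg L)
      simp only [hd]
      linarith
    -- The sign is needed to multiply the upper bound `hAq` by this factor.
    have hfac : 0 ≤ 1 - u * d l + u ^ 2 * L ^ 2 := by
      have := h3 l
      have := mul_nonneg (sq_nonneg u) (sq_nonneg L)
      linarith
    calc _ ≤ (∑ k, A l k * (p k + u * r k)) *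
          ((1 - u * d l + u ^ 2 * L ^ 2) * ‖(wo - W) l‖ ^ 2) :=
          mul_le_mul_of_nonneg_left hs hAq0
      _ = (∑ k, A l k * (p k + u * r k)) * (1 - u * d l + u ^ 2 * L ^ 2) * ‖(wo - W) l‖ ^ 2 := by
          ring
      _ ≤ (1 - c / 4 * u) * (p l + u * r l) * ‖(wo - W) l‖ ^ 2 := by
          refine mul_le_mul_of_nonneg_right ?_ (sq_nonneg _)
          exact (mul_le_mul_of_nonneg_right hAq hfac).trans
            (weight_step_le (hp l) hc (hd0 l) hu h4 (h1 l) (h2 l))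
      _ = _ := by ring

/-! ### Fourth moments under conditionally centered perturbations -/

section FourthMoment

/-- The term linear in `n` is kept exact, since it will average to zero. Cauchy-Schwarz reduces the
remaining cross terms to `8 ‖x‖² ‖n‖²`, which Young's inequality splits with parameter `δ`. -/
lemma norm_add_pow_four_le {E : Type*} [NormedAddCommGroup E] [InnerProductSpace ℝ E] (x n : E)
    {δ : ℝ} (hδ : 0 < δ) :
    ‖x + n‖ ^ 4 ≤ (1 + δ) * ‖x‖ ^ 4 + 4 * ⟪‖x‖ ^ 2 • x, n⟫ + (16 / δ + 3) * ‖n‖ ^ 4 := by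
  have h1 : ‖x + n‖ ^ 4 = (‖x‖ ^ 2 + 2 * ⟪x, n⟫ + ‖n‖ ^ 2) ^ 2 := by
    rw [← norm_add_sq_real]; ring
  have h2 : ⟪x, n⟫ ^ 2 ≤ ‖x‖ ^ 2 * ‖n‖ ^ 2 := by
    rw [← mul_pow]
    exact sq_le_sq' (neg_le_of_abs_le (abs_real_inner_le_norm x n)) (real_inner_le_norm x n)
  have h3 : 8 * (‖x‖ ^ 2 * ‖n‖ ^ 2) ≤ δ * ‖x‖ ^ 4 + 16 / δ * ‖n‖ ^ 4 := by
    have : 0 ≤ (δ * ‖x‖ ^ 2 - 4 * ‖n‖ ^ 2) ^ 2 / δ := by positivity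
    have e : (δ * ‖x‖ ^ 2 - 4 * ‖n‖ ^ 2) ^ 2 / δ =
        δ * ‖x‖ ^ 4 + 16 / δ * ‖n‖ ^ 4 - 8 * (‖x‖ ^ 2 * ‖n‖ ^ 2) := by
      field_simp
      ring
    linarith
  rw [h1, inner_smul_left, conj_trivial]
  nlinarith [sq_nonneg (⟪x, n⟫ - ‖n‖ ^ 2)]

variable {Ω : Type*} {mΩ : MeasurableSpace Ω} {P : Measure Ω}

lemma integrable_norm_pow_four {E : Type*} [NormedAddCommGroup E] {f : Ω → E}
    (hf : MemLp f 4 P) : Integrable (fun ω => ‖f ω‖ ^ 4) P :=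
  MemLp.integrable_norm_pow (p := 4) (by simpa using hf) (by norm_num)

lemma memLp_four_of_integrable {E : Type*} [NormedAddCommGroup E] {f : Ω → E}
    (hm : AEStronglyMeasurable f P) (hf : Integrable (fun ω => ‖f ω‖ ^ 4) P) : MemLp f 4 P := by
  rw [← integrable_norm_rpow_iff hm (by norm_num) (by norm_num)]
  refine hf.congr (ae_of_all _ fun ω => ?_)
  have : (4 : ℝ≥0∞).toReal = ((4 : ℕ) : ℝ) := by norm_num
  simp only [this, Real.rpow_natCast]

/-- Adding noise with zero conditional mean changes the fourth moment only by a small multiple of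
itself and a multiple of the fourth moment of the noise. -/
lemma integral_norm_add_pow_four_le {E : Type*} [NormedAddCommGroup E] [InnerProductSpace ℝ E]
    [CompleteSpace E] [IsProbabilityMeasure P] {m : MeasurableSpace Ω} (hm : m ≤ mΩ)
    {X n : Ω → E} (hX : StronglyMeasurable[m] X) (hX4 : MemLp X 4 P) (hn4 : MemLp n 4 P)
    (hn : P[n | m] =ᵐ[P] 0) {δ : ℝ} (hδ : 0 < δ) :
    ∫ ω, ‖X ω + n ω‖ ^ 4 ∂P ≤
      (1 + δ) * ∫ ω, ‖X ω‖ ^ 4 ∂P + (16 / δ + 3) * ∫ ω, ‖n ω‖ ^ 4 ∂P := by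
  have iX := integrable_norm_pow_four hX4
  have iN := integrable_norm_pow_four hn4
  have hZ : StronglyMeasurable[m] fun ω => ‖X ω‖ ^ 2 • X ω := (hX.norm.pow 2).smul hX
  have iZ : Integrable (fun ω => ⟪‖X ω‖ ^ 2 • X ω, n ω⟫) P := by
    refine (iX.add iN).mono' ((hZ.mono hm).aestronglyMeasurable.inner hn4.1)
      (ae_of_all _ fun ω => ?_)
    refine (norm_inner_le_norm _ _).trans ?_
    rw [norm_smul, Real.norm_eq_abs, abs_of_nonneg (sq_nonneg _), Pi.add_apply]
    have hx := norm_nonneg (X ω)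
    have hy := norm_nonneg (n ω)
    rcases le_total ‖X ω‖ ‖n ω‖ with h | h
    · calc ‖X ω‖ ^ 2 * ‖X ω‖ * ‖n ω‖ ≤ ‖n ω‖ ^ 2 * ‖n ω‖ * ‖n ω‖ := by gcongr
        _ ≤ ‖X ω‖ ^ 4 + ‖n ω‖ ^ 4 := by nlinarith [pow_nonneg hx 4]
    · calc ‖X ω‖ ^ 2 * ‖X ω‖ * ‖n ω‖ ≤ ‖X ω‖ ^ 2 * ‖X ω‖ * ‖X ω‖ := by gcongr
        _ ≤ ‖X ω‖ ^ 4 + ‖n ω‖ ^ 4 := by nlinarith [pow_nonneg hy 4]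
  -- The left factor is `m`-measurable and can be pulled out of the conditional expectation.
  have hzero : ∫ ω, ⟪‖X ω‖ ^ 2 • X ω, n ω⟫ ∂P = 0 := by
    have h := condExp_bilin_of_stronglyMeasurable_left
      ((isBoundedBilinearMap_inner (𝕜 := ℝ) (E := E)).toContinuousLinearMap) (μ := P) hZ
      (g := n) iZ (hn4.integrable (by norm_num))
    rw [← integral_condExp hm]
    refine (integral_congr_ae (g := fun _ => (0 : ℝ)) (h.trans ?_)).trans (integral_zero _ _)
    filter_upwards [hn] with ω hω
    rw [hω]
    simp
  have i1 : Integrable (fun ω => (1 + δ) * ‖X ω‖ ^ 4 + 4 * ⟪‖X ω‖ ^ 2 • X ω, n ω⟫) P :=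
    (iX.const_mul _).add (iZ.const_mul _)
  refine (integral_mono (integrable_norm_pow_four (hX4.add hn4)) (i1.add (iN.const_mul _))
    fun ω => norm_add_pow_four_le (X ω) (n ω) hδ).trans_eq ?_
  simp only [Pi.add_apply]
  rw [integral_add i1 (iN.const_mul _), integral_add (iX.const_mul _) (iZ.const_mul _),
    integral_const_mul, integral_const_mul, integral_const_mul, hzero]
  ring

end FourthMoment

/-! ### The error recursion and its fourth moment -/

section Recursion

variable {N M G : ℕ} {Ω : Type*} {mΩ : MeasurableSpace Ω} {P : Measure Ω}
  {ℱ : Filtration ℕ mΩ} {grp : Fin N → Fin G} {A : Matrix (Fin N) (Fin N) ℝ}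
  {J : Fin N → Vec M → ℝ} {wo : NetVec N M} {lamL lamU : Fin N → ℝ}
  {gHat : ℕ → Ω → Fin N → Vec M → Vec M} {α σ : ℝ}

/-- Averaging fixes `wo`, because it is constant on groups and `A` averages only within groups; so
no bias term appears. -/
lemma netError_succ (hA : IsCombinationPolicy grp A) (hJ : IsCostFamily grp J wo lamL lamU)
    (μ : Fin N → ℝ) (i : ℕ) (ω : Ω) :
    netError A μ gHat wo (i + 1) ω =
      combine A (wo - iterate A μ gHat i ω + scale μ (netGrad J (iterate A μ gHat i ω))) +
        combine A (scale μ (gradNoise J (gHat i ω) (iterate A μ gHat i ω))) := by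
  set W := iterate A μ gHat i ω with hW
  have hwo : ∀ k, wo k = ∑ l, A l k • wo l := fun k => by
    have : ∀ l, A l k • wo l = A l k • wo k := fun l => by
      by_cases h : grp l = grp k
      · rw [hJ.common_minimizer l k h]
      · rw [hA.off_group l k h, zero_smul, zero_smul]
    rw [Finset.sum_congr rfl fun l _ => this l, ← Finset.sum_smul, hA.leftStochastic, one_smul]
  rw [← map_add]
  ext k : 1
  rw [combine_apply]
  change wo k - ∑ l, A l k • (W l - μ l • gHat i ω l (W l)) = ∑ l, A l k •
    (wo l - W l + μ l • ∇ (J l) (W l) + μ l • (gHat i ω l (W l) - ∇ (J l) (W l)))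
  rw [hwo k, ← Finset.sum_sub_distrib]
  refine Finset.sum_congr rfl fun l _ => ?_
  rw [← smul_sub]
  congr 1
  module

lemma IsCostFamily.continuous_netGrad (hJ : IsCostFamily grp J wo lamL lamU) :
    Continuous (netGrad J) := by
  have h : ∀ k, Continuous (∇ (J k)) := fun k => (hJ.differentiable_gradient k).continuous
  unfold netGrad
  fun_prop

lemma norm_netGrad_le {L : ℝ} (hL : 0 < L) (h : ∀ k w, ‖∇ (J k) w‖ ≤ L * ‖wo k - w‖)
    (W : NetVec N M) : ‖netGrad J W‖ ≤ L * ‖wo - W‖ := by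
  rw [← sq_le_sq₀ (norm_nonneg _) (by positivity), mul_pow, PiLp.norm_sq_eq_of_L2,
    PiLp.norm_sq_eq_of_L2, Finset.mul_sum]
  refine Finset.sum_le_sum fun k _ => ?_
  rw [← mul_pow]
  exact pow_le_pow_left₀ (norm_nonneg _) (h k (W k)) 2

/-- The noise-free part of the error recursion is measurable and has a finite fourth moment. -/
lemma IsCostFamily.drift_regular [IsProbabilityMeasure P]
    (hJ : IsCostFamily grp J wo lamL lamU) (μ : Fin N → ℝ)
    {m : MeasurableSpace Ω} (hm : m ≤ mΩ) {W : Ω → NetVec N M} (hW : StronglyMeasurable[m] W)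
    (hW4 : MemLp W 4 P) :
    StronglyMeasurable[m] (fun ω => combine A (wo - W ω + scale μ (netGrad J (W ω)))) ∧
      MemLp (fun ω => combine A (wo - W ω + scale μ (netGrad J (W ω)))) 4 P := by
  obtain ⟨L, hL, hgL, -⟩ := hJ.exists_step_bound
  have hc := hJ.continuous_netGrad
  have he : MemLp (fun ω => wo - W ω) 4 P := (memLp_const wo).sub hW4
  have hg : StronglyMeasurable[m] fun ω => netGrad J (W ω) := hc.comp_stronglyMeasurable hW
  have hg4 : MemLp (fun ω => netGrad J (W ω)) 4 P :=
    he.of_le_mul (hg.mono hm).aestronglyMeasurable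
      (ae_of_all _ fun ω => norm_netGrad_le hL hgL (W ω))
  refine ⟨?_, ?_⟩
  · exact (combine A).continuous.comp_stronglyMeasurable
      ((stronglyMeasurable_const.sub hW).add ((scale μ).continuous.comp_stronglyMeasurable hg))
  · exact (combine A).comp_memLp' (he.add ((scale μ).comp_memLp' hg4))

lemma IsGradientNoise.memLp (hnoise : IsGradientNoise P ℱ J wo gHat α σ) (i : ℕ)
    {W : Ω → NetVec N M} (hW : StronglyMeasurable[ℱ i] W) (hW4 : MemLp W 4 P) :
    MemLp (fun ω => gradNoise J (gHat i ω) (W ω)) 4 P :=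
  memLp_four_of_integrable ((hnoise.adapted i W hW hW4).mono (ℱ.le _)).aestronglyMeasurable
    (hnoise.integrable i W hW hW4)

/-- This makes the noise hypotheses, which require measurability and a finite fourth moment,
applicable at every iterate. -/
lemma iterate_regular [IsProbabilityMeasure P] (hA : IsCombinationPolicy grp A)
    (hJ : IsCostFamily grp J wo lamL lamU) (hnoise : IsGradientNoise P ℱ J wo gHat α σ)
    (μ : Fin N → ℝ) (i : ℕ) :
    StronglyMeasurable[ℱ i] (iterate A μ gHat i) ∧ MemLp (iterate A μ gHat i) 4 P := by
  induction i with
  | zero => exact ⟨stronglyMeasurable_const, memLp_const 0⟩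
  | succ i ih =>
    obtain ⟨hW, hW4⟩ := ih
    obtain ⟨h1, h2⟩ := hJ.drift_regular (A := A) (P := P) μ (ℱ.le i) hW hW4
    have h3 := hnoise.adapted i _ hW hW4
    have h4 := hnoise.memLp i hW hW4
    have e : iterate A μ gHat (i + 1) = fun ω => wo -
        (combine A (wo - iterate A μ gHat i ω + scale μ (netGrad J (iterate A μ gHat i ω))) +
        combine A (scale μ (gradNoise J (gHat i ω) (iterate A μ gHat i ω)))) := by
      funext ω
      rw [← netError_succ hA hJ μ i ω, netError, sub_sub_cancel]
    rw [e]
    refine ⟨?_, ?_⟩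
    · exact stronglyMeasurable_const.sub ((h1.mono (ℱ.mono (Nat.le_succ i))).add
        ((combine A).continuous.comp_stronglyMeasurable
          ((scale μ).continuous.comp_stronglyMeasurable h3)))
    · exact (memLp_const wo).sub (h2.add ((combine A).comp_memLp' ((scale μ).comp_memLp' h4)))

lemma memLp_netError [IsProbabilityMeasure P] (hA : IsCombinationPolicy grp A)
    (hJ : IsCostFamily grp J wo lamL lamU) (hnoise : IsGradientNoise P ℱ J wo gHat α σ)
    (μ : Fin N → ℝ) (i : ℕ) : MemLp (netError A μ gHat wo i) 4 P :=
  (memLp_const wo).sub (iterate_regular hA hJ hnoise μ i).2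

lemma IsGradientNoise.integral_norm_pow_four_le [IsProbabilityMeasure P]
    (hnoise : IsGradientNoise P ℱ J wo gHat α σ) (i : ℕ)
    {W : Ω → NetVec N M} (hW : StronglyMeasurable[ℱ i] W) (hW4 : MemLp W 4 P) :
    ∫ ω, ‖gradNoise J (gHat i ω) (W ω)‖ ^ 4 ∂P ≤
      α ^ 2 * ∫ ω, ‖wo - W ω‖ ^ 4 ∂P + σ ^ 4 := by
  have he : Integrable (fun ω => ‖wo - W ω‖ ^ 4) P :=
    integrable_norm_pow_four ((memLp_const wo).sub hW4)
  rw [← integral_condExp (ℱ.le i)]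
  refine (integral_mono_ae integrable_condExp ((he.const_mul _).add (integrable_const _))
    (hnoise.fourthMoment i W hW hW4)).trans_eq ?_
  simp only [Pi.add_apply]
  rw [integral_add (he.const_mul _) (integrable_const _), integral_const_mul]
  simp

/-- One step of the recursion for the fourth moment of the weighted error. -/
lemma integral_scale_netError_succ_le [IsProbabilityMeasure P] (hA : IsCombinationPolicy grp A)
    (hJ : IsCostFamily grp J wo lamL lamU) (hnoise : IsGradientNoise P ℱ J wo gHat α σ)
    {a b κ u : ℝ} (ha : 0 < a) (hb : 0 < b) (hκ : 0 < κ) (hu : 0 < u) (hu1 : u ≤ 1)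
    (hκu : κ * u ≤ 1)
    (huK : u * ((16 / κ + 3) * (b * ‖combine (M := M) A‖) ^ 4 * (α ^ 2 / a ^ 2)) ≤ κ / 2)
    {t μ : Fin N → ℝ} (hta : ∀ k, a ≤ t k ^ 2) (htb : ∀ k, |t k| ≤ b) (hμ : ∀ k, |μ k| ≤ u)
    (hcontr : ∀ W : NetVec N M, ‖scale t (combine A (wo - W + scale μ (netGrad J W)))‖ ^ 2 ≤
      (1 - κ * u) * ‖scale t (wo - W)‖ ^ 2) (i : ℕ) :
    ∫ ω, ‖scale t (netError A μ gHat wo (i + 1) ω)‖ ^ 4 ∂P ≤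
      (1 - κ * u / 2) * ∫ ω, ‖scale t (netError A μ gHat wo i ω)‖ ^ 4 ∂P +
        (16 / κ + 3) * (b * ‖combine (M := M) A‖) ^ 4 * σ ^ 4 * u ^ 3 := by
  obtain ⟨hW, hW4⟩ := iterate_regular hA hJ hnoise μ i
  obtain ⟨h1, h2⟩ := hJ.drift_regular (A := A) (P := P) μ (ℱ.le i) hW hW4
  have hs4 := hnoise.memLp i hW hW4
  have he4 := memLp_netError hA hJ hnoise μ i
  set W := iterate A μ gHat i with hWdef
  set s : Ω → NetVec N M := fun ω => gradNoise J (gHat i ω) (W ω) with hs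
  set T : NetVec N M →L[ℝ] NetVec N M := (scale t).comp ((combine A).comp (scale μ)) with hT
  set K := ‖combine (M := M) A‖ with hK
  have hn : P[fun ω => T (s ω) | ℱ i] =ᵐ[P] 0 := by
    have hc := T.comp_condExp_comm (m := ℱ i) (hs4.integrable (by norm_num))
    refine hc.symm.trans ?_
    filter_upwards [hnoise.martingaleDifference i W hW hW4] with ω hω
    simp only [Function.comp_apply]
    rw [hω]
    simp
  -- With `δ = κ * u` the loss `1 + δ` uses up only one of the two factors `1 - κ * u` that the
  -- drift supplies.
  have key := integral_norm_add_pow_four_le (ℱ.le i)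
    ((scale t).continuous.comp_stronglyMeasurable h1) ((scale t).comp_memLp' h2)
    (T.comp_memLp' hs4) hn (mul_pos hκ hu)
  set Y := ∫ ω, ‖scale t (netError A μ gHat wo i ω)‖ ^ 4 ∂P with hY
  have iY : Integrable (fun ω => ‖scale t (netError A μ gHat wo i ω)‖ ^ 4) P :=
    integrable_norm_pow_four ((scale t).comp_memLp' he4)
  have hY0 : 0 ≤ Y := integral_nonneg fun ω => by positivity
  have hX : ∫ ω, ‖scale t (combine A (wo - W ω + scale μ (netGrad J (W ω))))‖ ^ 4 ∂P ≤
      (1 - κ * u) ^ 2 * Y := by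
    rw [hY, ← integral_const_mul]
    refine integral_mono (integrable_norm_pow_four ((scale t).comp_memLp' h2))
      (iY.const_mul _) fun ω => ?_
    have := pow_le_pow_left₀ (sq_nonneg _) (hcontr (W ω)) 2
    rw [mul_pow, ← pow_mul, ← pow_mul] at this
    exact this
  have hN : ∫ ω, ‖T (s ω)‖ ^ 4 ∂P ≤ (b * K) ^ 4 * u ^ 4 * ∫ ω, ‖s ω‖ ^ 4 ∂P := by
    rw [← integral_const_mul]
    refine integral_mono (integrable_norm_pow_four (T.comp_memLp' hs4))
      ((integrable_norm_pow_four hs4).const_mul _) fun ω => ?_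
    have : ‖T (s ω)‖ ≤ b * K * u * ‖s ω‖ := calc
      ‖T (s ω)‖ ≤ b * ‖combine A (scale μ (s ω))‖ := norm_scale_le hb.le htb _
      _ ≤ b * (K * ‖scale μ (s ω)‖) := by gcongr; exact (combine A).le_opNorm _
      _ ≤ b * (K * (u * ‖s ω‖)) := by gcongr; exact norm_scale_le hu.le hμ _
      _ = _ := by ring
    have h4 := pow_le_pow_left₀ (norm_nonneg _) this 4
    simpa only [mul_pow] using h4
  have hE : ∫ ω, ‖wo - W ω‖ ^ 4 ∂P ≤ Y / a ^ 2 := by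
    rw [le_div_iff₀ (by positivity), mul_comm, hY, ← integral_const_mul]
    refine integral_mono ((integrable_norm_pow_four he4).const_mul _) iY fun ω => ?_
    have := pow_le_pow_left₀ (by positivity) (le_norm_scale_sq hta (wo - W ω)) 2
    rw [mul_pow, ← pow_mul, ← pow_mul] at this
    exact this
  have hS : ∫ ω, ‖s ω‖ ^ 4 ∂P ≤ α ^ 2 / a ^ 2 * Y + σ ^ 4 := by
    refine (hnoise.integral_norm_pow_four_le i hW hW4).trans ?_
    have := mul_le_mul_of_nonneg_left hE (sq_nonneg α)
    have e : α ^ 2 / a ^ 2 * Y = α ^ 2 * (Y / a ^ 2) := by ring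
    linarith
  -- The factor `1 / δ` costs one of the four powers of `u` carried by the noise.
  have hcoef : (16 / (κ * u) + 3) * u ^ 4 ≤ (16 / κ + 3) * u ^ 3 := by
    have e : (16 / (κ * u) + 3) * u ^ 4 = 16 / κ * u ^ 3 + 3 * u ^ 3 * u := by
      field_simp
    rw [e]
    nlinarith [pow_pos hu 3]
  have hfirst : (1 + κ * u) *
      ∫ ω, ‖scale t (combine A (wo - W ω + scale μ (netGrad J (W ω))))‖ ^ 4 ∂P ≤ (1 - κ * u) * Y := by
    refine (mul_le_mul_of_nonneg_left hX (by positivity)).trans ?_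
    rw [← mul_assoc]
    refine mul_le_mul_of_nonneg_right ?_ hY0
    have h5 : 0 ≤ 1 - κ * u := by linarith
    have h6 := mul_nonneg h5 (sq_nonneg (κ * u))
    linarith
  have hS0 : 0 ≤ α ^ 2 / a ^ 2 * Y + σ ^ 4 := by positivity
  have hsecond : (16 / (κ * u) + 3) * ∫ ω, ‖T (s ω)‖ ^ 4 ∂P ≤
      κ * u / 2 * Y + (16 / κ + 3) * (b * K) ^ 4 * σ ^ 4 * u ^ 3 := by
    have hbK : 0 ≤ (b * K) ^ 4 := by positivity
    calc (16 / (κ * u) + 3) * ∫ ω, ‖T (s ω)‖ ^ 4 ∂P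
        ≤ (16 / (κ * u) + 3) * ((b * K) ^ 4 * u ^ 4 * (α ^ 2 / a ^ 2 * Y + σ ^ 4)) := by
          refine mul_le_mul_of_nonneg_left (hN.trans ?_) (by positivity)
          exact mul_le_mul_of_nonneg_left hS (by positivity)
      _ = (16 / (κ * u) + 3) * u ^ 4 * ((b * K) ^ 4 * (α ^ 2 / a ^ 2 * Y + σ ^ 4)) := by ring
      _ ≤ (16 / κ + 3) * u ^ 3 * ((b * K) ^ 4 * (α ^ 2 / a ^ 2 * Y + σ ^ 4)) :=
          mul_le_mul_of_nonneg_right hcoef (mul_nonneg hbK hS0)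
      _ = u * ((16 / κ + 3) * (b * K) ^ 4 * (α ^ 2 / a ^ 2)) * (u ^ 2 * Y) +
          (16 / κ + 3) * (b * K) ^ 4 * σ ^ 4 * u ^ 3 := by ring
      -- By `huK`, the part of the noise that grows with the error uses up half of the contraction.
      _ ≤ κ / 2 * (u * Y) + (16 / κ + 3) * (b * K) ^ 4 * σ ^ 4 * u ^ 3 := by
          have : u ^ 2 * Y ≤ u * Y := mul_le_mul_of_nonneg_right (by nlinarith) hY0
          gcongr
      _ = _ := by ring
  have hlhs : ∀ ω, scale t (netError A μ gHat wo (i + 1) ω) =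
      scale t (combine A (wo - W ω + scale μ (netGrad J (W ω)))) + T (s ω) := fun ω => by
    rw [netError_succ hA hJ μ i ω, map_add]
    rfl
  simp only [hlhs]
  simp only [Function.comp_apply] at key
  linarith

end Recursion

/-! ### Passage to the limit -/

lemma le_of_affine_recursion {y : ℕ → ℝ} {δ B : ℝ} (hδ : 0 < δ) (hδ1 : δ ≤ 1)
    (h : ∀ i, y (i + 1) ≤ (1 - δ) * y i + B) (i : ℕ) :
    y i ≤ (1 - δ) ^ i * (y 0 - B / δ) + B / δ := by
  induction i with
  | zero => simp
  | succ i ih =>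
    refine (h i).trans ?_
    have h1 := mul_le_mul_of_nonneg_left ih (sub_nonneg.2 hδ1)
    have h2 : δ * (B / δ) = B := mul_div_cancel₀ B hδ.ne'
    rw [pow_succ]
    linarith

lemma limsup_lintegral_enorm_pow_le {Ω E : Type*} {mΩ : MeasurableSpace Ω} {P : Measure Ω}
    [NormedAddCommGroup E] {f : ℕ → Ω → E} {n : ℕ} {z : ℕ → ℝ} {l : ℝ}
    (hf : ∀ i, Integrable (fun ω => ‖f i ω‖ ^ n) P) (hz : ∀ i, ∫ ω, ‖f i ω‖ ^ n ∂P ≤ z i)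
    (hl : Tendsto z atTop (nhds l)) :
    limsup (fun i : ℕ => ∫⁻ ω, ‖f i ω‖ₑ ^ n ∂P) atTop ≤ ENNReal.ofReal l := by
  have h1 : ∀ i, ∫⁻ ω, ‖f i ω‖ₑ ^ n ∂P ≤ ENNReal.ofReal (z i) := fun i => by
    refine le_of_eq_of_le ?_ (ENNReal.ofReal_le_ofReal (hz i))
    rw [ofReal_integral_eq_lintegral_ofReal (hf i) (ae_of_all _ fun ω => by positivity)]
    exact lintegral_congr fun ω => by
      rw [ENNReal.ofReal_pow (norm_nonneg _), ofReal_norm]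
  rw [← (ENNReal.tendsto_ofReal hl).limsup_eq]
  exact limsup_le_limsup (Eventually.of_forall h1)

end DiffusionNetwork

theorem mainTheorem2 {N M G : ℕ} {Ω : Type*} {mΩ : MeasurableSpace Ω}
    (P : Measure Ω) [IsProbabilityMeasure P] (ℱ : Filtration ℕ mΩ)
    (grp : Fin N → Fin G) (A : Matrix (Fin N) (Fin N) ℝ)
    (J : Fin N → DiffusionNetwork.Vec M → ℝ) (wo : DiffusionNetwork.NetVec N M)
    (lamL lamU : Fin N → ℝ)
    (gHat : ℕ → Ω → Fin N → DiffusionNetwork.Vec M → DiffusionNetwork.Vec M) (α σ : ℝ)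
    (hA : DiffusionNetwork.IsCombinationPolicy grp A)
    (hJ : DiffusionNetwork.IsCostFamily grp J wo lamL lamU)
    (hα : 0 ≤ α) (hσ : 0 ≤ σ)
    (hnoise : DiffusionNetwork.IsGradientNoise P ℱ J wo gHat α σ) :
    ∀ ρ : ℝ, 0 < ρ → ∃ μ₀ C : ℝ, 0 < μ₀ ∧ 0 ≤ C ∧
      ∀ μ : Fin N → ℝ, (∀ k, 0 < μ k) → (∀ k, ρ * DiffusionNetwork.muMax μ ≤ μ k) →
        DiffusionNetwork.muMax μ ≤ μ₀ →
        limsup (fun i : ℕ => ∫⁻ ω, ‖DiffusionNetwork.netError A μ gHat wo i ω‖ₑ ^ 2 ∂P) atTop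
            ≤ ENNReal.ofReal (C * DiffusionNetwork.muMax μ) ∧
        limsup (fun i : ℕ => ∫⁻ ω, ‖DiffusionNetwork.netError A μ gHat wo i ω‖ₑ ^ 4 ∂P) atTop
            ≤ ENNReal.ofReal (C * DiffusionNetwork.muMax μ ^ 2) := by
  open DiffusionNetwork in
  intro ρ hρ
  rcases isEmpty_or_nonempty (Fin N) with hN | hN
  · have h0 : ∀ (μ : Fin N → ℝ) i ω, netError A μ gHat wo i ω = 0 := fun μ i ω =>
      Subsingleton.elim _ _
    exact ⟨1, 0, one_pos, le_rfl, fun μ _ _ _ => by simp [h0]⟩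
  obtain ⟨a, b, κ, ha, hb, hκ, hev⟩ := exists_contracting_weights hA hJ hρ
  set K₂ := (16 / κ + 3) * (b * ‖combine (M := M) A‖) ^ 4 with hK₂
  have hK₂0 : 0 ≤ K₂ := by positivity
  have hev' := (((hev.and (eventually_mul_le 1 one_pos)).and (eventually_mul_le κ one_pos)).and
    (eventually_mul_le (K₂ * (α ^ 2 / a ^ 2)) (half_pos hκ)))
  obtain ⟨μ₁, hμ₁, hsub⟩ := mem_nhdsGT_iff_exists_Ioo_subset.1 hev'
  -- The fixed point `K₂ * σ ^ 4 * u ^ 3 / (κ * u / 2)` of the recursion, divided by `u ^ 2` and by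
  -- the factor `a ^ 2` that undoes the weights.
  set C₄ := 2 * (K₂ * σ ^ 4) / (κ * a ^ 2) with hC₄
  have hC₄0 : 0 ≤ C₄ := by positivity
  -- Halving `μ₁` keeps `u` inside the open interval; the extra `1` is the price of the
  -- second-moment bound `h2`.
  refine ⟨μ₁ / 2, 1 + C₄, half_pos hμ₁, by positivity, fun μ hμ hμρ hμ₀ => ?_⟩
  set u := muMax μ with hu_def
  have hμu : ∀ k, μ k ≤ u := fun k => le_ciSup (Set.finite_range μ).bddAbove k
  have hu : 0 < u := (hμ (Classical.arbitrary _)).trans_le (hμu _)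
  obtain ⟨⟨⟨⟨t, hta, htb, hcontr⟩, hu1⟩, hκu⟩, huK⟩ :=
    hsub ⟨hu, hμ₀.trans_lt (half_lt_self hμ₁)⟩
  rw [mul_one] at hu1
  rw [mul_comm] at hκu
  have hμabs : ∀ k, |μ k| ≤ u := fun k => by rw [abs_of_pos (hμ k)]; exact hμu k
  have hrec := le_of_affine_recursion
    (y := fun i => ∫ ω, ‖scale t (netError A μ gHat wo i ω)‖ ^ 4 ∂P)
    (δ := κ * u / 2) (B := K₂ * σ ^ 4 * u ^ 3) (by positivity) (by linarith)
    (fun i => integral_scale_netError_succ_le hA hJ hnoise ha hb hκ hu hu1 hκu huK hta htb hμabs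
      (hcontr μ hμρ hμu) i)
  have he4 := memLp_netError hA hJ hnoise μ
  set D := K₂ * σ ^ 4 * u ^ 3 / (κ * u / 2) with hD
  set y₀ := ∫ ω, ‖scale t (netError A μ gHat wo 0 ω)‖ ^ 4 ∂P
  set z : ℕ → ℝ := fun i => ((1 - κ * u / 2) ^ i * (y₀ - D) + D) / a ^ 2 with hz
  have h4 : ∀ i, ∫ ω, ‖netError A μ gHat wo i ω‖ ^ 4 ∂P ≤ z i := fun i => by
    rw [hz, le_div_iff₀ (by positivity), mul_comm]
    refine le_trans ?_ (hrec i)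
    rw [← integral_const_mul]
    refine integral_mono ((integrable_norm_pow_four (he4 i)).const_mul _)
      (integrable_norm_pow_four ((scale t).comp_memLp' (he4 i))) fun ω => ?_
    have := pow_le_pow_left₀ (by positivity) (le_norm_scale_sq hta (netError A μ gHat wo i ω)) 2
    rw [mul_pow, ← pow_mul, ← pow_mul] at this
    exact this
  have hzl : Tendsto z atTop (nhds (C₄ * u ^ 2)) := by
    have hp : Tendsto (fun i : ℕ => (1 - κ * u / 2) ^ i) atTop (nhds 0) :=
      tendsto_pow_atTop_nhds_zero_of_lt_one (by linarith) (by linarith [mul_pos hκ hu])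
    have := ((hp.mul_const (y₀ - D)).add_const D).div_const (a ^ 2)
    have e : (0 * (y₀ - D) + D) / a ^ 2 = C₄ * u ^ 2 := by
      rw [hD, hC₄]
      field_simp
      ring
    rwa [e] at this
  have i2 : ∀ i, Integrable (fun ω => ‖netError A μ gHat wo i ω‖ ^ 2) P := fun i =>
    ((he4 i).mono_exponent (by norm_num : (2 : ℝ≥0∞) ≤ 4)).integrable_norm_pow (by norm_num)
  -- Young's inequality `x ≤ u + x ^ 2 / u`, at the scale `u` where both terms have the same order
  -- in the limit.
  have h2 : ∀ i, ∫ ω, ‖netError A μ gHat wo i ω‖ ^ 2 ∂P ≤ u + z i / u := fun i => by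
    have i4 := integrable_norm_pow_four (he4 i)
    calc ∫ ω, ‖netError A μ gHat wo i ω‖ ^ 2 ∂P
        ≤ ∫ ω, (u + ‖netError A μ gHat wo i ω‖ ^ 4 / u) ∂P := by
          refine integral_mono (i2 i) ((integrable_const u).add (i4.div_const u)) fun ω => ?_
          dsimp only
          set x := ‖netError A μ gHat wo i ω‖ ^ 2 with hx
          rw [show ‖netError A μ gHat wo i ω‖ ^ 4 = x ^ 2 by rw [hx]; ring,
            ← sub_le_iff_le_add', le_div_iff₀ hu]
          nlinarith [sq_nonneg (x - u), sq_nonneg x, sq_nonneg u]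
      _ = u + (∫ ω, ‖netError A μ gHat wo i ω‖ ^ 4 ∂P) / u := by
          rw [integral_add (integrable_const u) (i4.div_const u), integral_div]
          simp
      _ ≤ u + z i / u := by
          have := h4 i
          gcongr
  refine ⟨?_, ?_⟩
  · refine limsup_lintegral_enorm_pow_le i2 h2 ?_
    have := (hzl.div_const u).const_add u
    rwa [show u + C₄ * u ^ 2 / u = (1 + C₄) * u by field_simp] at this
  · refine (limsup_lintegral_enorm_pow_le (fun i => integrable_norm_pow_four (he4 i))
      h4 hzl).trans (ENNReal.ofReal_le_ofReal ?_)
    nlinarith [sq_nonneg u]
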